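/- **Theorem 5.2.** A rational function $f\in\mathbb C(z_1,z_2)$ is called a *rational inner function* on the bidisc $\mathbb D^2=\{(z_1,z_2):|z_1|<1,\ |z_2|<1\}$ if it is analytic on $\mathbb D^2$ with $|f|\le 1$ there, and $|f|=1$ almost everywhere on the torus $\mathbb T^2$. Its bidegree is $(d_1,d_2)$, where $d_i$ is the degree in $z_i$ of the numerator of $f$ in an irreducible (lowest terms) representation. Let $f$ and $g$ be rational inner functions on $\mathbb D^2$ with bidegrees $(d_1,d_2)$ and $(e_1,e_2)$, and let $q$ and $r$ be their numerators in irreducible representations. Assume that $q$ and $r$ have no common factor in $\mathbb C[z_1,z_2]$ (other than constants), i.e. that their zero curves have no common component. Then $q$ and $r$ have only finitely many common zeros in $\mathbb C^2$, and the number of common zeros of $f$ and $g$ in $\mathbb C^2$, counted with multiplicity, satisfies $$|Z_f\cap Z_g| \;:=\; \sum_{\substack{\lambda\in\mathbb C^2\\ q(\lambda)=r(\lambda)=0}} (Z_q\cdot Z_r)_\lambda \;\le\; d_1e_2+d_2e_1 ,$$ where $(Z_q\cdot Z_r)_\lambda=\dim_{\mathbb C}\mathcal O_\lambda/(q,r)$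 is the intersection number of the two curves at $\lambda$ and $\mathcal O_\lambda$ is the local ring of $\mathbb C^2$ at $\lambda$ (the localization of $\mathbb C[z_1,z_2]$ at the maximal ideal of $\lambda$). -/

import Mathlib

/-- The open bidisc in `ℂ²`. -/
def bidisc : Set (Fin 2 → ℂ) := {z | ∀ i, ‖z i‖ < 1}

/-- The Schur class of the bidisc: analytic functions from the bidisc to the closed unit disc. -/
def schurClass : Set ((Fin 2 → ℂ) → ℂ) :=
  {F | AnalyticOnNhd ℂ F bidisc ∧ ∀ z ∈ bidisc, ‖F z‖ ≤ 1}

/-- The field `ℂ(z₁, z₂)` of rational functions in two variables. -/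
abbrev RationalFunction : Type := FractionRing (MvPolynomial (Fin 2) ℂ)

namespace RationalFunction

/-- The numerator in an irreducible representation (unique up to a non-zero constant factor). -/
noncomputable def numer (f : RationalFunction) : MvPolynomial (Fin 2) ℂ :=
  IsFractionRing.num (MvPolynomial (Fin 2) ℂ) f

/-- The denominator in the same irreducible representation. -/
noncomputable def denom (f : RationalFunction) : MvPolynomial (Fin 2) ℂ :=
  (IsFractionRing.den (MvPolynomial (Fin 2) ℂ) f : MvPolynomial (Fin 2) ℂ)

/-- The value of a rational function at a point which is not a zero of the denominator. -/
noncomputable def value (f : RationalFunction) (z : Fin 2 → ℂ) : ℂ :=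
  MvPolynomial.eval z f.numer / MvPolynomial.eval z f.denom

/-- A rational inner function on the bidisc: a rational function which on the bidisc is (equal to)
a function in the Schur class, and which has modulus one almost everywhere on the torus. The torus
is parametrized by angles; `torusMap 0 1 θ = (exp (i θ₁), exp (i θ₂))`. The zero set of the
denominator is a null set in the torus, so the value used there plays no role. -/
def IsInner (f : RationalFunction) : Prop :=
  (∃ F ∈ schurClass, ∀ z ∈ bidisc,
    MvPolynomial.eval z f.denom * F z = MvPolynomial.eval z f.numer) ∧
  ∀ᵐ θ : Fin 2 → ℝ, ‖f.value (torusMap 0 1 θ)‖ = 1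

/-- The degree of a rational function in the `i`-th variable, as used for rational inner functions:
the degree of the numerator of an irreducible representation in that variable. -/
noncomputable def deg (f : RationalFunction) (i : Fin 2) : ℕ := f.numer.degreeOf i

end RationalFunction

/-- The maximal ideal of `ℂ[z₁, z₂]` of all polynomials that vanish at the point `a`. -/
noncomputable def pointIdeal (a : Fin 2 → ℂ) : Ideal (MvPolynomial (Fin 2) ℂ) :=
  RingHom.ker (MvPolynomial.eval a)

instance pointIdeal_isPrime (a : Fin 2 → ℂ) : (pointIdeal a).IsPrime :=
  RingHom.ker_isPrime (MvPolynomial.eval a)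

/-- The local ring of the affine plane `ℂ²` at the point `a`. -/
abbrev planeLocalRing (a : Fin 2 → ℂ) : Type := Localization.AtPrime (pointIdeal a)

/-- The intersection number at `a` of the plane curves `q = 0` and `r = 0`: the dimension over `ℂ`
of the quotient of the local ring at `a` by the ideal generated by `q` and `r`, which is `⊤` if that
quotient is infinite-dimensional. -/
noncomputable def intersectionNumber (q r : MvPolynomial (Fin 2) ℂ) (a : Fin 2 → ℂ) : ℕ∞ :=
  Cardinal.toENat (Module.rank ℂ (planeLocalRing a ⧸
    (Ideal.span {algebraMap (MvPolynomial (Fin 2) ℂ) (planeLocalRing a) q,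
      algebraMap (MvPolynomial (Fin 2) ℂ) (planeLocalRing a) r} : Ideal (planeLocalRing a))))

/-- The set of common zeros in `ℂ²` of two rational functions, i.e. of their numerators. -/
def commonZeros (f g : RationalFunction) : Set (Fin 2 → ℂ) :=
  {a | MvPolynomial.eval a f.numer = 0 ∧ MvPolynomial.eval a g.numer = 0}

/-- The number of common zeros in `ℂ²` counted with multiplicity: the sum of the intersection
numbers of the zero curves of the two numerators over all common zeros. The sum is taken in `ℕ∞`,
as the supremum of its finite partial sums, so it is `⊤` whenever there are infinitely many common
zeros. -/
noncomputable def numCommonZeros (f g : RationalFunction) : ℕ∞ :=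
  ⨆ S : Finset (commonZeros f g), ∑ a ∈ S, intersectionNumber f.numer g.numer a

/-!
Bézout's theorem for two curves of given bidegrees, proved by counting dimensions in boxes.

Let `q` and `r` be coprime of bidegrees `(d₁, d₂)` and `(e₁, e₂)`. Among the polynomials of degree
less than `M` in the first and less than `N` in the second variable, `M` and `N` large, the
multiples of `q` and those of `r` form spaces of dimension `(M - d₁) (N - d₂)` and
`(M - e₁) (N - e₂)`. By coprimality they meet in the multiples of `q * r`, a space of dimension
`(M - d₁ - e₁) (N - d₂ - e₂)`. So the image of the box in `A = ℂ[z₁, z₂] ⧸ (q, r)` has dimension at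
most `M N - (M - d₁) (N - d₂) - (M - e₁) (N - e₂) + (M - d₁ - e₁) (N - d₂ - e₂) = d₁ e₂ + d₂ e₁`
(`finrank_map_mk_degreeBox_le`). The boxes exhaust the polynomial ring, hence
`dim A ≤ d₁ e₂ + d₂ e₁` (`rank_quotient_span_pair_le`).

So `A` is Artinian: it has finitely many prime ideals, and it is the product of its localizations
at them. The common zeros of `q` and `r` give distinct primes of `A`, and the localization of `A` at
the prime of `a` is the quotient of the local ring of the plane at `a` by `(q, r)`, whose dimension
is the intersection number. Therefore there are finitely many common zeros, and the sum of their
intersection numbers is at most `dim A` (`sum_intersectionNumber_le`).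
-/

open MvPolynomial

/-! ### Boxes of polynomials of bounded bidegree -/

/-- The polynomials of degree less than `m` in the first and less than `n` in the second variable.
The bounds are strict, so that the dimension is `m * n`. -/
noncomputable def degreeBox (m n : ℕ) : Submodule ℂ (MvPolynomial (Fin 2) ℂ) :=
  restrictSupport ℂ {v | v 0 < m ∧ v 1 < n}

theorem mem_degreeBox {m n : ℕ} {p : MvPolynomial (Fin 2) ℂ} :
    p ∈ degreeBox m n ↔ ∀ v ∈ p.support, v 0 < m ∧ v 1 < n :=
  mem_restrictSupport_iff ℂ

theorem mem_degreeBox_of_ne_zero {m n : ℕ} {p : MvPolynomial (Fin 2) ℂ} (hp : p ≠ 0) :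
    p ∈ degreeBox m n ↔ p.degreeOf 0 < m ∧ p.degreeOf 1 < n := by
  obtain ⟨v, hv⟩ := support_nonempty.mpr hp
  rw [mem_degreeBox]
  constructor
  · intro h
    have := h v hv
    rw [degreeOf_lt_iff (by omega), degreeOf_lt_iff (by omega)]
    exact ⟨fun w hw ↦ (h w hw).1, fun w hw ↦ (h w hw).2⟩
  · rintro ⟨h₀, h₁⟩ w hw
    exact ⟨(degreeOf_lt_iff (by omega)).1 h₀ w hw, (degreeOf_lt_iff (by omega)).1 h₁ w hw⟩

/-- The exponents of the monomials in `degreeBox m n`, as pairs of bounded numbers. -/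
noncomputable def degreeBoxEquiv (m n : ℕ) :
    {v : Fin 2 →₀ ℕ | v 0 < m ∧ v 1 < n} ≃ Fin m × Fin n :=
  (Equiv.subtypeEquiv (Finsupp.equivFunOnFinite.trans (finTwoArrowEquiv ℕ))
    (q := fun x ↦ x.1 < m ∧ x.2 < n) (fun _ ↦ Iff.rfl)).trans
    (Equiv.subtypeProdEquivProd.trans
      (Fin.equivSubtype.symm.prodCongr Fin.equivSubtype.symm))

/-- The basis of `degreeBox m n` that consists of monomials. -/
noncomputable def basisDegreeBox (m n : ℕ) :
    Module.Basis (Fin m × Fin n) ℂ (degreeBox m n) :=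
  (basisRestrictSupport ℂ _).reindex (degreeBoxEquiv m n)

instance (m n : ℕ) : Module.Finite ℂ (degreeBox m n) :=
  Module.Finite.of_basis (basisDegreeBox m n)

theorem finrank_degreeBox (m n : ℕ) : Module.finrank ℂ (degreeBox m n) = m * n := by
  simp [Module.finrank_eq_card_basis (basisDegreeBox m n)]

theorem mul_mem_degreeBox {m n : ℕ} {q p : MvPolynomial (Fin 2) ℂ} (hp : p ∈ degreeBox m n) :
    q * p ∈ degreeBox (q.degreeOf 0 + m) (q.degreeOf 1 + n) := by
  rcases eq_or_ne p 0 with rfl | hp0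
  · simp
  rcases eq_or_ne q 0 with rfl | hq0
  · simp
  rw [mem_degreeBox_of_ne_zero hp0] at hp
  rw [mem_degreeBox_of_ne_zero (mul_ne_zero hq0 hp0), degreeOf_mul_eq hq0 hp0,
    degreeOf_mul_eq hq0 hp0]
  omega

theorem mem_degreeBox_of_mul_mem {m n : ℕ} {q p : MvPolynomial (Fin 2) ℂ} (hq : q ≠ 0)
    (h : q * p ∈ degreeBox (q.degreeOf 0 + m) (q.degreeOf 1 + n)) : p ∈ degreeBox m n := by
  rcases eq_or_ne p 0 with rfl | hp0
  · simp
  rw [mem_degreeBox_of_ne_zero (mul_ne_zero hq hp0), degreeOf_mul_eq hq hp0,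
    degreeOf_mul_eq hq hp0] at h
  rw [mem_degreeBox_of_ne_zero hp0]
  omega

theorem degreeBox_mono {m n m' n' : ℕ} (hm : m ≤ m') (hn : n ≤ n') :
    degreeBox m n ≤ degreeBox m' n' :=
  restrictSupport_mono ℂ fun _ hv ↦ ⟨hv.1.trans_le hm, hv.2.trans_le hn⟩

theorem exists_mem_degreeBox (p : MvPolynomial (Fin 2) ℂ) : ∃ k, p ∈ degreeBox k k := by
  rcases eq_or_ne p 0 with rfl | hp
  · exact ⟨0, zero_mem _⟩
  · exact ⟨p.degreeOf 0 + p.degreeOf 1 + 1, (mem_degreeBox_of_ne_zero hp).2 (by omega)⟩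

/-! ### The dimension of the quotient by two coprime polynomials -/

/-- The kernel of the projection of a large box to the quotient contains the multiples of `q` and
the multiples of `r` in the box; as these meet only in multiples of `q * r`, it is large. -/
theorem finrank_map_mk_degreeBox_le {q r : MvPolynomial (Fin 2) ℂ} (hq : q ≠ 0) (hr : r ≠ 0)
    (hqr : IsRelPrime q r) (k : ℕ) :
    Module.finrank ℂ ((degreeBox (q.degreeOf 0 + r.degreeOf 0 + k)
      (q.degreeOf 1 + r.degreeOf 1 + k)).map
        (Ideal.Quotient.mkₐ ℂ (Ideal.span {q, r})).toLinearMap) ≤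
      q.degreeOf 0 * r.degreeOf 1 + q.degreeOf 1 * r.degreeOf 0 := by
  set V := degreeBox (q.degreeOf 0 + r.degreeOf 0 + k) (q.degreeOf 1 + r.degreeOf 1 + k) with hV
  set π := (Ideal.Quotient.mkₐ ℂ (Ideal.span {q, r})).toLinearMap
  set X := (degreeBox (r.degreeOf 0 + k) (r.degreeOf 1 + k)).map (LinearMap.mulLeft ℂ q) with hX
  set Y := (degreeBox (q.degreeOf 0 + k) (q.degreeOf 1 + k)).map (LinearMap.mulLeft ℂ r) with hY
  have hXV : X ≤ V := by
    rintro _ ⟨p, hp, rfl⟩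
    simpa [hV, add_assoc] using mul_mem_degreeBox (q := q) hp
  have hYV : Y ≤ V := by
    rintro _ ⟨p, hp, rfl⟩
    simpa [hV, add_assoc, add_left_comm] using mul_mem_degreeBox (q := r) hp
  have hXr : Module.finrank ℂ X = (r.degreeOf 0 + k) * (r.degreeOf 1 + k) := by
    rw [← finrank_degreeBox]
    exact (Submodule.equivMapOfInjective _ (mul_right_injective₀ hq) _).finrank_eq.symm
  have hYr : Module.finrank ℂ Y = (q.degreeOf 0 + k) * (q.degreeOf 1 + k) := by
    rw [← finrank_degreeBox]
    exact (Submodule.equivMapOfInjective _ (mul_right_injective₀ hr) _).finrank_eq.symm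
  have hinf : Module.finrank ℂ (X ⊓ Y : Submodule ℂ _) ≤ k * k := by
    rw [← finrank_degreeBox]
    refine (Submodule.finrank_mono ?_).trans
      (Submodule.finrank_map_le (LinearMap.mulLeft ℂ (q * r)) (degreeBox k k))
    rintro p ⟨⟨a, ha, rfl⟩, ⟨b, hb, hab⟩⟩
    simp only [LinearMap.mulLeft_apply] at hab
    -- Here `q * a = r * b`, and `r` is coprime to `q`.
    obtain ⟨c, rfl⟩ : r ∣ a := hqr.symm.dvd_of_dvd_mul_left ⟨b, hab.symm⟩
    exact ⟨c, mem_degreeBox_of_mul_mem hr ha, by simp⟩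
  have hker : X ⊔ Y ≤ (LinearMap.ker (π.domRestrict V)).map V.subtype := by
    rw [LinearMap.ker_domRestrict, Submodule.map_comap_subtype]
    refine le_inf (sup_le hXV hYV) (sup_le ?_ ?_)
    · rintro _ ⟨p, -, rfl⟩
      exact Ideal.Quotient.eq_zero_iff_mem.2
        (Ideal.mul_mem_right _ _ (Ideal.subset_span (Set.mem_insert _ _)))
    · rintro _ ⟨p, -, rfl⟩
      exact Ideal.Quotient.eq_zero_iff_mem.2
        (Ideal.mul_mem_right _ _ (Ideal.subset_span (Set.mem_insert_of_mem _ rfl)))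
  have h1 := Submodule.finrank_sup_add_finrank_inf_eq X Y
  have h2 := (Submodule.finrank_mono hker).trans (Submodule.finrank_map_le _ _)
  have h3 := (π.domRestrict V).finrank_range_add_finrank_ker
  rw [LinearMap.range_domRestrict, finrank_degreeBox] at h3
  have h4 : (q.degreeOf 0 + r.degreeOf 0 + k) * (q.degreeOf 1 + r.degreeOf 1 + k) + k * k
      = (r.degreeOf 0 + k) * (r.degreeOf 1 + k) + (q.degreeOf 0 + k) * (q.degreeOf 1 + k)
        + (q.degreeOf 0 * r.degreeOf 1 + q.degreeOf 1 * r.degreeOf 0) := by ring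
  omega

theorem rank_quotient_span_pair_le {q r : MvPolynomial (Fin 2) ℂ} (hqr : IsRelPrime q r) :
    Module.rank ℂ (MvPolynomial (Fin 2) ℂ ⧸ Ideal.span {q, r}) ≤
      (q.degreeOf 0 * r.degreeOf 1 + q.degreeOf 1 * r.degreeOf 0 : ℕ) := by
  -- If one polynomial vanishes, then the other one is a unit and the quotient is zero.
  by_cases h0 : q = 0 ∨ r = 0
  · have htop : Ideal.span {q, r} = ⊤ := by
      rcases h0 with rfl | rfl
      · exact Ideal.eq_top_of_isUnit_mem _ (Ideal.subset_span (by simp))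
          (isRelPrime_zero_left.1 hqr)
      · exact Ideal.eq_top_of_isUnit_mem _ (Ideal.subset_span (by simp))
          (isRelPrime_zero_right.1 hqr)
    have := Ideal.Quotient.subsingleton_iff.2 htop
    simp
  obtain ⟨hq, hr⟩ := not_or.1 h0
  -- A finite linearly independent set in the quotient lies in the image of a single box.
  refine rank_le fun s hs ↦ ?_
  choose lift hlift using Ideal.Quotient.mk_surjective (I := Ideal.span {q, r})
  choose k hk using fun x ↦ exists_mem_degreeBox (lift x)
  set π := (Ideal.Quotient.mkₐ ℂ (Ideal.span {q, r})).toLinearMap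
  have hle : Submodule.span ℂ (s : Set (MvPolynomial (Fin 2) ℂ ⧸ Ideal.span {q, r})) ≤
      (degreeBox (q.degreeOf 0 + r.degreeOf 0 + s.sup k)
        (q.degreeOf 1 + r.degreeOf 1 + s.sup k)).map π := by
    refine Submodule.span_le.2 fun x hx ↦ ⟨lift x, ?_, hlift x⟩
    have := Finset.le_sup (f := k) hx
    exact degreeBox_mono (by omega) (by omega) (hk x)
  rw [← finrank_span_finset_eq_card hs]
  exact (Submodule.finrank_mono hle).trans (finrank_map_mk_degreeBox_le hq hr hqr _)

/-! ### Localizations of a finite-dimensional algebra -/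

/-- A finite-dimensional algebra is Artinian, hence maps onto the product of its localizations at
any family of distinct primes. -/
theorem sum_finrank_localization_le {K A ι : Type*} [Field K] [CommRing A] [Algebra K A]
    [Module.Finite K A] [Fintype ι] (P : ι → PrimeSpectrum A) (hP : Function.Injective P)
    (B : ι → Type*) [∀ i, CommRing (B i)] [∀ i, Algebra K (B i)] [∀ i, Algebra A (B i)]
    [∀ i, IsScalarTower K A (B i)] [∀ i, IsLocalization.AtPrime (B i) (P i).asIdeal] :
    (∀ i, Module.Finite K (B i)) ∧
      ∑ i, Module.finrank K (B i) ≤ Module.finrank K A := by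
  have : IsArtinianRing A := .of_finite K A
  let e (i : ι) : Localization.AtPrime (P i).asIdeal ≃ₐ[A] B i :=
    IsLocalization.algEquiv (P i).asIdeal.primeCompl _ _
  let π : A →ₗ[K] Π i, B i := (Algebra.ofId A (Π i, B i)).toLinearMap.restrictScalars K
  have hπ : Function.Surjective π := by
    intro y
    -- Extend the lift of `y` from the primes `P i` to all primes.
    have hex (p : PrimeSpectrum A) : ∃ w : Localization.AtPrime p.asIdeal,
        ∀ i, ∀ h : P i = p, h ▸ (e i).symm (y i) = w := by
      by_cases h : ∃ i, P i = p
      · obtain ⟨i, rfl⟩ := h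
        refine ⟨(e i).symm (y i), fun j hj ↦ ?_⟩
        obtain rfl := hP hj
        rfl
      · exact ⟨0, fun i hi ↦ (h ⟨i, hi⟩).elim⟩
    choose w hw using hex
    obtain ⟨x, hx⟩ := (PrimeSpectrum.toPiLocalization_bijective (R := A)).2 w
    refine ⟨x, funext fun i ↦ ?_⟩
    have hxi : algebraMap A _ x = (e i).symm (y i) := (congr_fun hx (P i)).trans (hw _ i rfl).symm
    exact ((e i).commutes x).symm.trans ((congr_arg (e i) hxi).trans ((e i).apply_symm_apply _))
  have hB (i : ι) : Module.Finite K (B i) :=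
    Module.Finite.of_surjective (LinearMap.proj i ∘ₗ π)
      ((Function.surjective_eval i).comp hπ)
  refine ⟨hB, ?_⟩
  rw [← Module.finrank_pi_fintype K]
  exact LinearMap.finrank_le_finrank_of_surjective hπ

/-! ### Intersection numbers as dimensions of localizations of the quotient -/

theorem mem_pointIdeal {a : Fin 2 → ℂ} {p : MvPolynomial (Fin 2) ℂ} :
    p ∈ pointIdeal a ↔ eval a p = 0 :=
  RingHom.mem_ker

theorem pointIdeal_injective : Function.Injective pointIdeal := by
  intro a b hab
  funext i
  have h : X i - C (a i) ∈ pointIdeal b := hab ▸ mem_pointIdeal.2 (by simp)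
  rw [mem_pointIdeal] at h
  simpa [sub_eq_zero, eq_comm] using h

theorem span_pair_le_pointIdeal {q r : MvPolynomial (Fin 2) ℂ} {a : Fin 2 → ℂ}
    (hq : eval a q = 0) (hr : eval a r = 0) : Ideal.span {q, r} ≤ pointIdeal a := by
  rw [Ideal.span_le, Set.insert_subset_iff, Set.singleton_subset_iff]
  exact ⟨hq, hr⟩

/-- The prime ideal of `ℂ[z₁, z₂] ⧸ I` given by a point at which all members of `I` vanish. -/
noncomputable def quotientPoint {I : Ideal (MvPolynomial (Fin 2) ℂ)} {a : Fin 2 → ℂ}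
    (h : I ≤ pointIdeal a) :
    PrimeSpectrum (MvPolynomial (Fin 2) ℂ ⧸ I) :=
  ⟨(pointIdeal a).map (Ideal.Quotient.mk I),
    Ideal.map_isPrime_of_surjective Ideal.Quotient.mk_surjective (by simpa using h)⟩

theorem comap_quotientPoint {I : Ideal (MvPolynomial (Fin 2) ℂ)} {a : Fin 2 → ℂ}
    (h : I ≤ pointIdeal a) :
    (quotientPoint h).asIdeal.comap (Ideal.Quotient.mk I) = pointIdeal a := by
  simp [quotientPoint, Ideal.comap_map_of_surjective _ Ideal.Quotient.mk_surjective,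
    ← RingHom.ker_eq_comap_bot, h]

theorem eq_of_quotientPoint_eq {I : Ideal (MvPolynomial (Fin 2) ℂ)} {a b : Fin 2 → ℂ}
    (ha : I ≤ pointIdeal a) (hb : I ≤ pointIdeal b) (h : quotientPoint ha = quotientPoint hb) :
    a = b :=
  pointIdeal_injective <| by rw [← comap_quotientPoint ha, ← comap_quotientPoint hb, h]

/-- Localization commutes with the quotient by `I`. -/
theorem isLocalization_quotientPoint {I : Ideal (MvPolynomial (Fin 2) ℂ)} {a : Fin 2 → ℂ}
    (h : I ≤ pointIdeal a) :
    IsLocalization.AtPrime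
      (planeLocalRing a ⧸ I.map (algebraMap (MvPolynomial (Fin 2) ℂ) (planeLocalRing a)))
      (quotientPoint h).asIdeal := by
  have hM : (quotientPoint h).asIdeal.primeCompl =
      Algebra.algebraMapSubmonoid (MvPolynomial (Fin 2) ℂ ⧸ I) (pointIdeal a).primeCompl := by
    ext x
    constructor
    · obtain ⟨p, rfl⟩ := Ideal.Quotient.mk_surjective x
      exact fun hp ↦ ⟨p, fun hpa ↦ hp (Ideal.mem_map_of_mem _ hpa), rfl⟩
    · rintro ⟨p, hp, rfl⟩ hpa
      exact hp (comap_quotientPoint h ▸ hpa : p ∈ pointIdeal a)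
  rw [IsLocalization.AtPrime, hM]
  infer_instance

theorem sum_intersectionNumber_le {q r : MvPolynomial (Fin 2) ℂ}
    (hqr : Module.Finite ℂ (MvPolynomial (Fin 2) ℂ ⧸ Ideal.span {q, r}))
    (S : Finset (Fin 2 → ℂ)) (hS : ∀ a ∈ S, eval a q = 0 ∧ eval a r = 0) :
    ∑ a ∈ S, intersectionNumber q r a ≤
      Module.finrank ℂ (MvPolynomial (Fin 2) ℂ ⧸ Ideal.span {q, r}) := by
  have hle (a : S) := span_pair_le_pointIdeal (hS a a.2).1 (hS a a.2).2
  have := fun a : S ↦ isLocalization_quotientPoint (hle a)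
  have (a : S) : IsScalarTower ℂ (MvPolynomial (Fin 2) ℂ ⧸ Ideal.span {q, r})
      (planeLocalRing a ⧸ (Ideal.span {q, r}).map
        (algebraMap (MvPolynomial (Fin 2) ℂ) (planeLocalRing a))) :=
    IsScalarTower.to₁₃₄ ℂ (MvPolynomial (Fin 2) ℂ) _ _
  obtain ⟨_, hsum⟩ := sum_finrank_localization_le (K := ℂ) (fun a : S ↦ quotientPoint (hle a))
    (fun a b hab ↦ Subtype.ext <| eq_of_quotientPoint_eq (hle a) (hle b) hab)
    (fun a : S ↦ planeLocalRing a ⧸ (Ideal.span {q, r}).map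
      (algebraMap (MvPolynomial (Fin 2) ℂ) (planeLocalRing a)))
  have hnum (a : S) : intersectionNumber q r a = Module.finrank ℂ
      (planeLocalRing a ⧸ (Ideal.span {q, r}).map
        (algebraMap (MvPolynomial (Fin 2) ℂ) (planeLocalRing a))) := by
    rw [intersectionNumber, ← Set.image_pair, ← Ideal.map_span, ← Module.finrank_eq_rank,
      Cardinal.toENat_nat]
  rw [← Finset.sum_coe_sort]
  simp_rw [hnum]
  exact_mod_cast hsum

theorem finite_commonZeros {q r : MvPolynomial (Fin 2) ℂ}
    (hqr : Module.Finite ℂ (MvPolynomial (Fin 2) ℂ ⧸ Ideal.span {q, r})) :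
    {a | eval a q = 0 ∧ eval a r = 0}.Finite := by
  have : IsArtinianRing (MvPolynomial (Fin 2) ℂ ⧸ Ideal.span {q, r}) := .of_finite ℂ _
  exact Finite.of_injective (fun a : {a | eval a q = 0 ∧ eval a r = 0} ↦
    quotientPoint (span_pair_le_pointIdeal a.2.1 a.2.2))
    fun a b hab ↦ Subtype.ext <| eq_of_quotientPoint_eq _ _ hab

theorem theorem5p2 (f g : RationalFunction) (hf : f.IsInner) (hg : g.IsInner)
    (hfg : IsRelPrime f.numer g.numer) :
    (commonZeros f g).Finite ∧
      numCommonZeros f g ≤ ((f.deg 0 * g.deg 1 + f.deg 1 * g.deg 0 : ℕ) : ℕ∞) := by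
  have hrank : Module.rank ℂ (MvPolynomial (Fin 2) ℂ ⧸ Ideal.span {f.numer, g.numer}) ≤
      (f.deg 0 * g.deg 1 + f.deg 1 * g.deg 0 : ℕ) := rank_quotient_span_pair_le hfg
  have hfin : Module.Finite ℂ (MvPolynomial (Fin 2) ℂ ⧸ Ideal.span {f.numer, g.numer}) :=
    Module.rank_lt_aleph0_iff.1 (hrank.trans_lt (Cardinal.natCast_lt_aleph0))
  refine ⟨finite_commonZeros hfin, iSup_le fun S ↦ ?_⟩
  have h := sum_intersectionNumber_le hfin (S.map (Function.Embedding.subtype (· ∈ commonZeros f g)))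
    fun a ha ↦ by
    obtain ⟨b, -, rfl⟩ := Finset.mem_map.1 ha
    exact b.2
  rw [Finset.sum_map] at h
  refine h.trans ?_
  rw [← Module.finrank_eq_rank] at hrank
  exact_mod_cast hrank
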